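/- A continuity modulus is a function $\gamma$ assigning to each $\varepsilon>0$ some $\gamma(\varepsilon)>0$. Fix continuity moduli $\mathcal F_0=(F_{0,n})_{n\in\omega}$ and $\mathcal F=(F_{n,m})_{n,m\in\omega}$, and a function $\nu:\omega\times\omega\to\omega$ that is non-decreasing in each argument. Let $G$ be a metric group (a topological group whose topology is given by a metric $d$) with a presentation $G=\bigcup_{n\in\omega}K_n$, where $K_0\subseteq K_1\subseteq\dots$ are closed sets of bounded diameter, $\{1\}\cup K_nK_n\cup K_n^{-1}\subseteq K_{n+1}$, and multiplication $K_n\times K_n\to K_{n+1}$ is uniformly continuous with modulus $F_{0,n}$, i.e. $d(x,x'),d(y,y')<F_{0,n}(\varepsilon)$ implies $d(xy,x'y')<\varepsilon$. An action of $G$ (or of a subgroup $A=\bigcup_n (A\cap K_n)$) by isometries on a real Hilbert space with closed balls $B_m=\{v:\|v\|\le m\}$ is called $\mathcal F$-continuous (or an $\mathcal F$-action) if for all $n,m$ its restriction to $K_n\times B_m$ (resp. $(A\cap K_n)\times B_m$) is uniformly continuous with modulus $F_{n,m}$, in the same sense. It induces a structure from $\mathcal K_{GH}(\nu,\mathcal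 F)$ if moreover it maps $K_n\times B_m$ into $B_{\nu(n,m)}$ for all $n,m$. A subgroup $A\le G$ is continuously elementary if $(\{A\cap K_n\}_{n},\cdot,{}^{-1},1)$ is an elementary substructure of the many-sorted continuous structure $(\{K_n\}_n,\cdot,{}^{-1},1)$: every formula of continuous logic (built from distances between terms of the same sort by the connectives $x/2$, $x\dot- y$, $\min$, $\max$, $|x-y|$, $q-x$, $\min(x+y,q)$, rational constants $q$, and quantifiers $\sup$, $\inf$ over the sorts) has the same value in both structures at every tuple from the substructure. The subgroup $A$ has property $\mathbf{FH}$ for $\mathcal F$-actions if every $\mathcal F$-continuous affine isometric action of $A$ on a real Hilbert space has a fixed point. **Proposition.** Suppose that there is an isometric action of $G$ on a real Hilbert space, inducing a structure from $\mathcal K_{GH}(\nu,\mathcal F)$, without fixed points. Then for every infinite subset $C\subseteq G$ there is a closed, continuously elementary subgroup $A$ of $G$ containing $C$, of the same density character as $C$ (the density character being the least cardinality of a dense subset), and without property $\mathbf{FH}$ for $\mathcal F$-actions. -/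

import Mathlib

/-- The density character of a topological space: the least cardinality of a dense subset. -/
noncomputable def densityCharacter (X : Type*) [TopologicalSpace X] : Cardinal :=
  ⨅ D : {D : Set X // Dense D}, Cardinal.mk (D : Set X)

/-- A continuity modulus: to each `ε > 0` it assigns a `δ > 0`. -/
structure ContinuityModulus where
  toFun : ℝ → ℝ
  pos : ∀ ε : ℝ, 0 < ε → 0 < toFun ε

instance : CoeFun ContinuityModulus (fun _ => ℝ → ℝ) := ⟨ContinuityModulus.toFun⟩

/-- A presentation `G = ⋃ Kₙ` of a metric group as the union of an increasing sequence of
closed subsets of bounded diameter with `{1} ∪ Kₙ·Kₙ ∪ Kₙ⁻¹ ⊆ Kₙ₊₁`, such that multiplication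
`Kₙ × Kₙ → Kₙ₊₁` is uniformly continuous with continuity modulus `F₀ n`. (Uniform continuity
of inversion on each `Kₙ` is then automatic: write `x⁻¹ = (x⁻¹ y) y⁻¹`, `y⁻¹ = (x⁻¹ x) y⁻¹`.) -/
structure IsPresentation {G : Type*} [Group G] [MetricSpace G]
    (F₀ : ℕ → ContinuityModulus) (K : ℕ → Set G) : Prop where
  isClosed : ∀ n, IsClosed (K n)
  mono : Monotone K
  isBounded : ∀ n, Bornology.IsBounded (K n)
  iUnion_eq : ⋃ n, K n = Set.univ
  one_mem : ∀ n, (1 : G) ∈ K (n + 1)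
  mul_mem : ∀ n, ∀ x ∈ K n, ∀ y ∈ K n, x * y ∈ K (n + 1)
  inv_mem : ∀ n, ∀ x ∈ K n, x⁻¹ ∈ K (n + 1)
  mul_modulus : ∀ n, ∀ ε > 0, ∀ x ∈ K n, ∀ x' ∈ K n, ∀ y ∈ K n, ∀ y' ∈ K n,
    dist x x' < F₀ n ε → dist y y' < F₀ n ε → dist (x * y) (x' * y') < ε

/-! ### Many-sorted continuous logic for the structures `({Kₙ}, ·, ⁻¹, 1)`

There is one sort for every `n : ℕ`. A context `s : Fin k → ℕ` lists the sorts of the free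
variables. -/

/-- Terms, indexed by the context `s` and by the sort of the term. -/
inductive GroupTerm {k : ℕ} (s : Fin k → ℕ) : ℕ → Type
  | var (i : Fin k) : GroupTerm s (s i)
  | one (n : ℕ) : GroupTerm s (n + 1)
  | mul {n : ℕ} (t u : GroupTerm s n) : GroupTerm s (n + 1)
  | inv {n : ℕ} (t : GroupTerm s n) : GroupTerm s (n + 1)

/-- Continuous formulas. As the sorts need not have diameter at most `1`, rational constants are
allowed, and the connectives `1 - x` and `min (x + y) 1` are available with every rational bound
`q` in place of `1`. -/
inductive GroupFormula : {k : ℕ} → (Fin k → ℕ) → Type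
  | const {k : ℕ} {s : Fin k → ℕ} (q : ℚ) : GroupFormula s
  | dist {k : ℕ} {s : Fin k → ℕ} {n : ℕ} (t u : GroupTerm s n) : GroupFormula s
  | half {k : ℕ} {s : Fin k → ℕ} (φ : GroupFormula s) : GroupFormula s
  | monus {k : ℕ} {s : Fin k → ℕ} (φ ψ : GroupFormula s) : GroupFormula s
  | min {k : ℕ} {s : Fin k → ℕ} (φ ψ : GroupFormula s) : GroupFormula s
  | max {k : ℕ} {s : Fin k → ℕ} (φ ψ : GroupFormula s) : GroupFormula s
  | absDiff {k : ℕ} {s : Fin k → ℕ} (φ ψ : GroupFormula s) : GroupFormula s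
  | neg {k : ℕ} {s : Fin k → ℕ} (q : ℚ) (φ : GroupFormula s) : GroupFormula s
  | truncAdd {k : ℕ} {s : Fin k → ℕ} (q : ℚ) (φ ψ : GroupFormula s) : GroupFormula s
  | sup {k : ℕ} {s : Fin k → ℕ} (n : ℕ)
      (φ : GroupFormula (Fin.cons n s : Fin (k + 1) → ℕ)) : GroupFormula s
  | inf {k : ℕ} {s : Fin k → ℕ} (n : ℕ)
      (φ : GroupFormula (Fin.cons n s : Fin (k + 1) → ℕ)) : GroupFormula s

/-- The value of a term under an assignment `v` of elements of `G` to the variables. -/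
def GroupTerm.eval {G : Type*} [Group G] {k : ℕ} {s : Fin k → ℕ} (v : Fin k → G) :
    {n : ℕ} → GroupTerm s n → G
  | _, .var i => v i
  | _, .one _ => 1
  | _, .mul t u => t.eval v * u.eval v
  | _, .inv t => (t.eval v)⁻¹

/-- The value of a formula in the structure whose sort `n` is `S n ⊆ G`: the quantifiers of
sort `n` range over `S n`. -/
noncomputable def GroupFormula.eval {G : Type*} [Group G] [MetricSpace G] (S : ℕ → Set G) :
    {k : ℕ} → {s : Fin k → ℕ} → GroupFormula s → (Fin k → G) → ℝ
  | _, _, .const q, _ => (q : ℝ)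
  | _, _, .dist t u, v => Dist.dist (t.eval v) (u.eval v)
  | _, _, .half φ, v => φ.eval S v / 2
  | _, _, .monus φ ψ, v => Max.max (φ.eval S v - ψ.eval S v) 0
  | _, _, .min φ ψ, v => Min.min (φ.eval S v) (ψ.eval S v)
  | _, _, .max φ ψ, v => Max.max (φ.eval S v) (ψ.eval S v)
  | _, _, .absDiff φ ψ, v => |φ.eval S v - ψ.eval S v|
  | _, _, .neg q φ, v => (q : ℝ) - φ.eval S v
  | _, _, .truncAdd q φ ψ, v => Min.min (φ.eval S v + ψ.eval S v) (q : ℝ)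
  | k, _, .sup n φ, v => ⨆ x : S n, φ.eval S (Fin.cons (x : G) v : Fin (k + 1) → G)
  | k, _, .inf n φ, v => ⨅ x : S n, φ.eval S (Fin.cons (x : G) v : Fin (k + 1) → G)

/-- The subgroup `A` of `G = ⋃ Kₙ` is continuously elementary: the substructure
`({A ∩ Kₙ}, ·, ⁻¹, 1)` of `({Kₙ}, ·, ⁻¹, 1)` is elementary, i.e. every formula takes the same
value in both structures at all tuples (of the appropriate sorts) from the substructure. -/
def IsContinuouslyElementary {G : Type*} [Group G] [MetricSpace G] (K : ℕ → Set G)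
    (A : Subgroup G) : Prop :=
  ∀ (k : ℕ) (s : Fin k → ℕ) (φ : GroupFormula s) (v : Fin k → G),
    (∀ i, v i ∈ (A : Set G) ∩ K (s i)) →
      φ.eval (fun n => (A : Set G) ∩ K n) v = φ.eval K v

/-! ### Actions on real Hilbert spaces -/

/-- `act` is `F`-continuous with respect to `G = ⋃ Kₙ`: the restriction of the action to
`Kₙ × Bₘ` has continuity modulus `F n m`, where `Bₘ` is the closed `m`-ball at `0`. -/
def IsFContinuousAction {G E : Type*} [MetricSpace G] [NormedAddCommGroup E]
    (K : ℕ → Set G) (F : ℕ → ℕ → ContinuityModulus) (act : G → E → E) : Prop :=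
  ∀ n m : ℕ, ∀ ε > 0, ∀ g ∈ K n, ∀ g' ∈ K n, ∀ v v' : E, ‖v‖ ≤ m → ‖v'‖ ≤ m →
    dist g g' < F n m ε → dist v v' < F n m ε → dist (act g v) (act g' v') < ε

/-- The isometric action `α` of `G = ⋃ Kₙ` on the real Hilbert space `E` induces a structure from
`K_GH(ν, F)`: the group sorts `Kₙ` form an `F₀`-continuous presentation of `G`, the action
maps `Kₙ × Bₘ` to `B_{ν(n,m)}`, and these maps are `F`-continuous. -/
structure InducesKGH {G E : Type*} [Group G] [MetricSpace G] [NormedAddCommGroup E]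
    [InnerProductSpace ℝ E] [CompleteSpace E] (F₀ : ℕ → ContinuityModulus) (ν : ℕ → ℕ → ℕ)
    (F : ℕ → ℕ → ContinuityModulus) (K : ℕ → Set G) (α : G →* (E ≃ᵢ E)) : Prop where
  presentation : IsPresentation F₀ K
  mapsTo : ∀ n m : ℕ, ∀ g ∈ K n, ∀ v : E, ‖v‖ ≤ m → ‖α g v‖ ≤ ν n m
  fContinuous : IsFContinuousAction K F (fun g v => α g v)

universe u v

/-- Property FH for `F`-actions of `G = ⋃ Kₙ`: every `F`-continuous affine isometric action of
`G` on a real Hilbert space has a fixed point. -/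
def HasFHForFActions (G : Type u) [Group G] [MetricSpace G] (K : ℕ → Set G)
    (F : ℕ → ℕ → ContinuityModulus) : Prop :=
  ∀ (E : Type v) [NormedAddCommGroup E] [InnerProductSpace ℝ E] [CompleteSpace E]
    (α : G →* (E ≃ᵃⁱ[ℝ] E)), IsFContinuousAction K F (fun g x => α g x) →
      ∃ x : E, ∀ g : G, α g x = x

/-!
An action by isometries on a Hilbert space with a bounded orbit fixes the Chebyshev centre of that
orbit (`exists_fixedPoint_of_isBounded_orbit`). Hence in a fixed point free action of `G` some
sequence `g` of elements of `G` moves `0` arbitrarily far, and then no subgroup `A` containing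
this sequence fixes a point. As the isometries are affine by the Mazur–Ulam theorem, the restriction
of the action to `A` refutes property FH for `A` (`not_hasFHForFActions_of_unbounded`).

It remains to find a closed elementary subgroup that contains `C` and `g` and has the density
character of `C`; this is the downward Löwenheim–Skolem theorem. Take a dense subset of `C` of the
least cardinality and close it, together with `g`, under the group operations and countably many
Skolem functions (`exists_isSkolemHull`): for each formula, almost minimizers over each sort, and
for each sort `K m`, points of `K m` almost nearest to a given element. There are only countably
many formulas, so the cardinality does not increase. The subgroup `A` is the closure of the
resulting subgroup `D`.

The almost nearest points make `D ∩ K m` dense in `A ∩ K m` for every `m`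
(`IsSkolemHull.exists_dist_lt`). Formulas are uniformly continuous on tuples of given sorts, so the
Tarski–Vaught property passes from parameters in `D` to parameters in `A`
(`IsSkolemHull.exists_eval_lt_add`), and induction on formulas shows that `A` is elementary. All
formulas are bounded on tuples of given sorts; this is why the infima and suprema of the
quantifiers are genuine. Over an empty sort they are `0` in both structures.
-/

open Cardinal Filter Topology Set

/-! ### Isometric actions with bounded orbits -/

/-- A bounded nonempty subset of a Hilbert space has a unique Chebyshev centre, that is, a unique
point around which a closed ball of the smallest possible radius contains the set. -/
theorem exists_unique_chebyshev_center {E : Type*} [NormedAddCommGroup E] [InnerProductSpace ℝ E]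
    [CompleteSpace E] {O : Set E} (hne : O.Nonempty) (hO : Bornology.IsBounded O) :
    ∃ R : ℝ, ∃! x : E, ∀ o ∈ O, dist x o ≤ R := by
  set P : Set ℝ := {t | ∃ x : E, ∀ o ∈ O, dist x o ≤ t} with hP
  obtain ⟨o₀, ho₀⟩ := hne
  have hP0 : ∀ t ∈ P, 0 ≤ t := by
    rintro t ⟨x, hx⟩
    exact dist_nonneg.trans (hx o₀ ho₀)
  have hPne : P.Nonempty := by
    obtain ⟨r, hr⟩ := hO.subset_closedBall o₀
    exact ⟨r, o₀, fun o ho => by simpa [dist_comm] using hr ho⟩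
  set R := sInf P with hR
  have hR0 : 0 ≤ R := le_csInf hPne hP0
  have hRle : ∀ t ∈ P, R ≤ t := fun t ht => csInf_le ⟨0, hP0⟩ ht
  -- The parallelogram law: two centres of balls of radius `t` are close to each other, since the
  -- midpoint is the centre of a smaller ball, whose radius is still at least `R`.
  have key : ∀ t x y, (∀ o ∈ O, dist x o ≤ t) → (∀ o ∈ O, dist y o ≤ t) →
      dist x y ^ 2 ≤ 4 * (t ^ 2 - R ^ 2) := by
    intro t x y hx hy
    have hmid : ∀ o ∈ O, dist (midpoint ℝ x y) o ^ 2 ≤ t ^ 2 - dist x y ^ 2 / 4 := by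
      intro o ho
      have h1 := parallelogram_law_with_norm ℝ (x - o) (y - o)
      have h2 : x - o + (y - o) = (2 : ℝ) • (midpoint ℝ x y - o) := by
        rw [smul_sub, midpoint_eq_smul_add, invOf_eq_inv, smul_inv_smul₀ two_ne_zero]
        module
      have h3 : x - o - (y - o) = x - y := by abel
      rw [h2, h3, norm_smul, ← dist_eq_norm, ← dist_eq_norm, ← dist_eq_norm, ← dist_eq_norm,
        Real.norm_two] at h1
      have h4 := pow_le_pow_left₀ dist_nonneg (hx o ho) 2
      have h5 := pow_le_pow_left₀ dist_nonneg (hy o ho) 2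
      nlinarith
    have hs : √(t ^ 2 - dist x y ^ 2 / 4) ∈ P :=
      ⟨midpoint ℝ x y, fun o ho => Real.le_sqrt_of_sq_le (hmid o ho)⟩
    have h6 := pow_le_pow_left₀ hR0 (hRle _ hs) 2
    rw [Real.sq_sqrt ((sq_nonneg _).trans (hmid o₀ ho₀))] at h6
    linarith
  let r : ℕ → ℝ := fun n => R + 1 / ((n : ℝ) + 1)
  have hr : Tendsto r atTop (𝓝 R) := by
    simpa [r] using tendsto_const_nhds.add (tendsto_one_div_add_atTop_nhds_zero_nat (𝕜 := ℝ))
  have hrpos : ∀ n, R < r n := fun n => lt_add_of_pos_right _ (by positivity)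
  let Z : ℕ → Set E := fun n => {x | ∀ o ∈ O, dist x o ≤ r n}
  have hZanti : Antitone Z := by
    intro m n hmn x hx o ho
    refine (hx o ho).trans ?_
    have : (m : ℝ) ≤ n := by exact_mod_cast hmn
    simp only [r]
    gcongr
  have hZne : ∀ n, (Z n).Nonempty := by
    intro n
    obtain ⟨t, ⟨x, hx⟩, ht⟩ := exists_lt_of_csInf_lt hPne (hrpos n)
    exact ⟨x, fun o ho => (hx o ho).trans ht.le⟩
  have hZclosed : ∀ n, IsClosed (Z n) := by
    intro n
    simp only [Z, Set.ofPred_forall]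
    exact isClosed_biInter fun o _ =>
      isClosed_le (continuous_id.dist continuous_const) continuous_const
  have hZb : ∀ n, Bornology.IsBounded (Z n) := fun n =>
    Metric.isBounded_closedBall.subset fun x hx => Metric.mem_closedBall.2 (hx o₀ ho₀)
  have hdiam : Tendsto (fun n => Metric.diam (Z n)) atTop (𝓝 0) := by
    refine squeeze_zero (g := fun n => √(4 * (r n ^ 2 - R ^ 2))) (fun n => Metric.diam_nonneg)
      (fun n => ?_) ?_
    · refine Metric.diam_le_of_forall_dist_le (Real.sqrt_nonneg _) fun x hx y hy => ?_
      exact Real.le_sqrt_of_sq_le (key _ _ _ hx hy)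
    · have := (((hr.pow 2).sub_const (R ^ 2)).const_mul 4).sqrt
      simpa using this
  obtain ⟨x, hx⟩ := Metric.nonempty_iInter_of_nonempty_biInter hZclosed hZb
    (fun N => (hZne N).mono (Set.subset_iInter₂ fun n hn => hZanti hn)) hdiam
  have hxR : ∀ o ∈ O, dist x o ≤ R := fun o ho =>
    ge_of_tendsto' hr fun n => Set.mem_iInter.1 hx n o ho
  refine ⟨R, x, hxR, fun y hy => ?_⟩
  have := key R y x hy hxR
  rw [sub_self, mul_zero] at this
  exact dist_eq_zero.1 (pow_eq_zero_iff two_ne_zero |>.1 (le_antisymm this (sq_nonneg _)))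

/-- A group of isometries of a Hilbert space with a bounded orbit has a fixed point, namely the
Chebyshev centre of that orbit. -/
theorem exists_fixedPoint_of_isBounded_orbit {G E : Type*} [Group G] [NormedAddCommGroup E]
    [InnerProductSpace ℝ E] [CompleteSpace E] (α : G →* (E ≃ᵢ E)) (p : E)
    (h : Bornology.IsBounded (range fun g => α g p)) : ∃ x : E, ∀ g, α g x = x := by
  obtain ⟨R, x, hx, huniq⟩ := exists_unique_chebyshev_center (range_nonempty _) h
  refine ⟨x, fun g => huniq _ ?_⟩
  rintro _ ⟨k, rfl⟩
  have h1 := hx _ ⟨g⁻¹ * k, rfl⟩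
  rw [← (α g).dist_eq, ← IsometryEquiv.mul_apply, ← map_mul, mul_inv_cancel_left] at h1
  exact h1

/-- The failure of the fixed point property is witnessed by a sequence: if a sequence in `G` moves
`0` arbitrarily far, then no subgroup containing the sequence fixes a point. -/
theorem exists_seq_unbounded_of_no_fixedPoint {G E : Type*} [Group G] [NormedAddCommGroup E]
    [InnerProductSpace ℝ E] [CompleteSpace E] (α : G →* (E ≃ᵢ E))
    (h : ¬ ∃ x : E, ∀ g, α g x = x) : ∃ g : ℕ → G, ∀ n : ℕ, n < ‖α (g n) 0‖ := by
  by_contra! hcon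
  have : ∃ n : ℕ, ∀ g, ‖α g 0‖ ≤ n := by
    by_contra! h'
    choose g hg using h'
    obtain ⟨n, hn⟩ := hcon g
    exact (hg n).not_ge hn
  obtain ⟨n, hn⟩ := this
  refine h (exists_fixedPoint_of_isBounded_orbit α 0 ?_)
  rw [isBounded_iff_forall_norm_le]
  exact ⟨n, by rintro _ ⟨g, rfl⟩; exact hn g⟩

/-! ### Density characters -/

theorem densityCharacter_le_of_dense {X : Type*} [TopologicalSpace X] {D : Set X} (hD : Dense D) :
    densityCharacter X ≤ #D :=
  ciInf_le' (fun D : {D : Set X // Dense D} => #(D : Set X)) ⟨D, hD⟩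

theorem densityCharacter_closure_le {X : Type*} [TopologicalSpace X] (S : Set X) :
    densityCharacter (closure S) ≤ #S := by
  refine (densityCharacter_le_of_dense (D := ((↑) : closure S → X) ⁻¹' S) ?_).trans
    (mk_preimage_of_injective _ _ Subtype.val_injective)
  rw [Subtype.dense_iff, Subtype.image_preimage_coe, inter_eq_right.2 subset_closure]

theorem exists_dense_mk_eq_densityCharacter (X : Type*) [TopologicalSpace X] :
    ∃ D : Set X, Dense D ∧ #D = densityCharacter X := by
  have : Nonempty {D : Set X // Dense D} := ⟨⟨univ, dense_univ⟩⟩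
  obtain ⟨D, hD⟩ := ciInf_mem (fun D : {D : Set X // Dense D} => #(D : Set X))
  exact ⟨D.1, D.2, hD⟩

theorem Dense.aleph0_le_mk {X : Type*} [TopologicalSpace X] [T1Space X] [Infinite X]
    {D : Set X} (hD : Dense D) : ℵ₀ ≤ #D := by
  rw [Cardinal.infinite_iff.symm, Set.infinite_coe_iff]
  intro hfin
  have : D = Set.univ := by rw [← hfin.isClosed.closure_eq, hD.closure_eq]
  exact Set.infinite_univ (this ▸ hfin)

theorem aleph0_le_densityCharacter (X : Type*) [TopologicalSpace X] [T1Space X] [Infinite X] :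
    ℵ₀ ≤ densityCharacter X := by
  obtain ⟨D, hD, hc⟩ := exists_dense_mk_eq_densityCharacter X
  exact hc ▸ hD.aleph0_le_mk

/-- The density character of metric spaces is monotone. (It is not for general spaces.) -/
theorem densityCharacter_mono {X : Type*} [MetricSpace X] {S T : Set X} (hST : S ⊆ T)
    (hS : S.Infinite) : densityCharacter S ≤ densityCharacter T := by
  have := (hS.mono hST).to_subtype
  obtain ⟨s₀, hs₀⟩ := hS.nonempty
  have : Nonempty S := ⟨⟨s₀, hs₀⟩⟩
  obtain ⟨D, hD, hc⟩ := exists_dense_mk_eq_densityCharacter T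
  rw [← hc]
  -- for each point `d` of the dense set and each `n`, a point of `S` at distance `< 1 / (n + 1)`
  -- from `d`, if there is one
  let c : D × ℕ → S := fun p =>
    Classical.epsilon fun s : S => dist (s : X) (p.1 : T) < 1 / ((p.2 : ℝ) + 1)
  have hdense : Dense (range c) := by
    rw [Metric.dense_iff]
    intro s ε hε
    obtain ⟨n, hn⟩ := exists_nat_one_div_lt (half_pos hε)
    obtain ⟨d, hds, hdD⟩ := Metric.dense_iff.1 hD ⟨s, hST s.2⟩ (1 / ((n : ℝ) + 1)) (by positivity)
    have hd : dist (s : X) (d : X) < 1 / ((n : ℝ) + 1) := by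
      rw [dist_comm]
      exact hds
    have hcs : dist (c (⟨d, hdD⟩, n) : X) (d : X) < 1 / ((n : ℝ) + 1) :=
      Classical.epsilon_spec (p := fun s : S => dist (s : X) (d : X) < 1 / ((n : ℝ) + 1)) ⟨s, hd⟩
    refine ⟨_, ?_, mem_range_self (⟨d, hdD⟩, n)⟩
    have := dist_triangle_right (c (⟨d, hdD⟩, n) : X) (s : X) (d : X)
    rw [Metric.mem_ball, Subtype.dist_eq]
    linarith
  calc densityCharacter S ≤ #(range c) := densityCharacter_le_of_dense hdense
    _ ≤ #(D × ℕ) := by simpa using mk_range_le_lift (f := c)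
    _ = #D := by
      rw [mk_prod, mk_nat, lift_aleph0, lift_uzero]
      exact mul_eq_left hD.aleph0_le_mk hD.aleph0_le_mk aleph0_ne_zero

/-! ### There are only countably many formulas -/

/-- A numerical code of a term. -/
def GroupTerm.code {k : ℕ} {s : Fin k → ℕ} : {n : ℕ} → GroupTerm s n → ℕ
  | _, .var i => Nat.pair 0 i
  | _, .one n => Nat.pair 1 n
  | _, .mul t u => Nat.pair 2 (Nat.pair t.code u.code)
  | _, .inv t => Nat.pair 3 t.code

/-- The code determines the sort of the term, too. -/
theorem GroupTerm.eq_of_code_eq {k : ℕ} {s : Fin k → ℕ} {n : ℕ} (t : GroupTerm s n) :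
    ∀ {m : ℕ} (t' : GroupTerm s m), t.code = t'.code → n = m ∧ t ≍ t' := by
  induction t with
  | var i =>
    intro m t' h
    cases t' <;> simp [code, Nat.pair_eq_pair, Fin.val_inj] at h
    subst h
    simp
  | one n =>
    intro m t' h
    cases t' <;> simp [code, Nat.pair_eq_pair] at h
    subst h
    simp
  | mul t u iht ihu =>
    intro m t' h
    cases t' <;> simp [code, Nat.pair_eq_pair] at h
    obtain ⟨rfl, ht⟩ := iht _ h.1
    obtain ⟨-, hu⟩ := ihu _ h.2
    simp [eq_of_heq ht, eq_of_heq hu]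
  | inv t iht =>
    intro m t' h
    cases t' <;> simp [code, Nat.pair_eq_pair] at h
    obtain ⟨rfl, ht⟩ := iht _ h
    simp [eq_of_heq ht]

/-- A numerical code of a formula. -/
def GroupFormula.code : {k : ℕ} → {s : Fin k → ℕ} → GroupFormula s → ℕ
  | _, _, .const q => Nat.pair 0 (Encodable.encode q)
  | _, _, .dist t u => Nat.pair 1 (Nat.pair t.code u.code)
  | _, _, .half φ => Nat.pair 2 φ.code
  | _, _, .monus φ ψ => Nat.pair 3 (Nat.pair φ.code ψ.code)
  | _, _, .min φ ψ => Nat.pair 4 (Nat.pair φ.code ψ.code)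
  | _, _, .max φ ψ => Nat.pair 5 (Nat.pair φ.code ψ.code)
  | _, _, .absDiff φ ψ => Nat.pair 6 (Nat.pair φ.code ψ.code)
  | _, _, .neg q φ => Nat.pair 7 (Nat.pair (Encodable.encode q) φ.code)
  | _, _, .truncAdd q φ ψ => Nat.pair 8 (Nat.pair (Encodable.encode q) (Nat.pair φ.code ψ.code))
  | _, _, .sup n φ => Nat.pair 9 (Nat.pair n φ.code)
  | _, _, .inf n φ => Nat.pair 10 (Nat.pair n φ.code)

theorem GroupFormula.code_injective {k : ℕ} {s : Fin k → ℕ} :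
    Function.Injective (code : GroupFormula s → ℕ) := by
  intro φ
  induction φ with
  | const q =>
    intro φ' h
    cases φ' <;> simp [code, Nat.pair_eq_pair] at h
    simp [h]
  | dist t u =>
    intro φ' h
    cases φ' <;> simp [code, Nat.pair_eq_pair] at h
    obtain ⟨rfl, ht⟩ := t.eq_of_code_eq _ h.1
    obtain ⟨-, hu⟩ := u.eq_of_code_eq _ h.2
    simp [eq_of_heq ht, eq_of_heq hu]
  | half φ ih =>
    intro φ' h
    cases φ' <;> simp [code, Nat.pair_eq_pair] at h
    rw [ih h]
  | monus φ ψ ih₁ ih₂ | min φ ψ ih₁ ih₂ | max φ ψ ih₁ ih₂ | absDiff φ ψ ih₁ ih₂ =>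
    intro φ' h
    cases φ' <;> simp [code, Nat.pair_eq_pair] at h
    rw [ih₁ h.1, ih₂ h.2]
  | neg q φ ih =>
    intro φ' h
    cases φ' <;> simp [code, Nat.pair_eq_pair] at h
    rw [h.1, ih h.2]
  | truncAdd q φ ψ ih₁ ih₂ =>
    intro φ' h
    cases φ' <;> simp [code, Nat.pair_eq_pair] at h
    rw [h.1, ih₁ h.2.1, ih₂ h.2.2]
  | sup n φ ih | inf n φ ih =>
    intro φ' h
    cases φ' <;> simp [code, Nat.pair_eq_pair] at h
    obtain ⟨rfl, h⟩ := h
    rw [ih h]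

instance {k : ℕ} (s : Fin k → ℕ) : Countable (GroupFormula s) :=
  GroupFormula.code_injective.countable

/-! ### Formulas are bounded and uniformly continuous -/

section Supremum

variable {ι : Type*} {f g : ι → ℝ} {c : ℝ}

-- For empty `ι` both suprema are `0`.
theorem abs_ciSup_sub_ciSup_le (hf : BddAbove (range f)) (hg : BddAbove (range g)) (hc : 0 ≤ c)
    (h : ∀ i, |f i - g i| ≤ c) : |(⨆ i, f i) - ⨆ i, g i| ≤ c := by
  rcases isEmpty_or_nonempty ι with hι | hι
  · simpa using hc
  · have h1 : ⨆ i, f i ≤ (⨆ i, g i) + c := ciSup_le fun i => by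
      linarith [(abs_le.1 (h i)).2, le_ciSup hg i]
    have h2 : ⨆ i, g i ≤ (⨆ i, f i) + c := ciSup_le fun i => by
      linarith [(abs_le.1 (h i)).1, le_ciSup hf i]
    rw [abs_le]
    constructor <;> linarith

theorem abs_ciInf_sub_ciInf_le (hf : BddBelow (range f)) (hg : BddBelow (range g)) (hc : 0 ≤ c)
    (h : ∀ i, |f i - g i| ≤ c) : |(⨅ i, f i) - ⨅ i, g i| ≤ c := by
  rcases isEmpty_or_nonempty ι with hι | hι
  · simpa using hc
  · have h1 : (⨅ i, g i) - c ≤ ⨅ i, f i := le_ciInf fun i => by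
      linarith [(abs_le.1 (h i)).1, ciInf_le hg i]
    have h2 : (⨅ i, f i) - c ≤ ⨅ i, g i := le_ciInf fun i => by
      linarith [(abs_le.1 (h i)).2, ciInf_le hf i]
    rw [abs_le]
    constructor <;> linarith

theorem bddAbove_range_of_abs_le (h : ∀ i, |f i| ≤ c) : BddAbove (range f) :=
  ⟨c, by rintro _ ⟨i, rfl⟩; exact (abs_le.1 (h i)).2⟩

theorem bddBelow_range_of_abs_le (h : ∀ i, |f i| ≤ c) : BddBelow (range f) :=
  ⟨-c, by rintro _ ⟨i, rfl⟩; exact (abs_le.1 (h i)).1⟩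

end Supremum

/-- The assignments that respect the sorts of the variables. -/
def sortedTuples {G : Type*} (K : ℕ → Set G) {k : ℕ} (s : Fin k → ℕ) : Set (Fin k → G) :=
  {v | ∀ i, v i ∈ K (s i)}

theorem cons_mem_sortedTuples {G : Type*} {K : ℕ → Set G} {k : ℕ} {s : Fin k → ℕ}
    {v : Fin k → G} (hv : v ∈ sortedTuples K s) {n : ℕ} {x : G} (hx : x ∈ K n) :
    (Fin.cons x v : Fin (k + 1) → G) ∈ sortedTuples K (Fin.cons n s : Fin (k + 1) → ℕ) := by
  intro i
  refine Fin.cases ?_ (fun j => ?_) i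
  · simpa using hx
  · simpa using hv j

theorem dist_cons_cons {G : Type*} [PseudoMetricSpace G] {k : ℕ} (x : G) (v w : Fin k → G) :
    dist (Fin.cons x v : Fin (k + 1) → G) (Fin.cons x w) = dist v w := by
  refine le_antisymm ((dist_pi_le_iff dist_nonneg).2 fun i => ?_)
    ((dist_pi_le_iff dist_nonneg).2 fun i => ?_)
  · refine Fin.cases ?_ (fun j => ?_) i
    · simp
    · simpa using dist_le_pi_dist v w j
  · simpa using
      dist_le_pi_dist (Fin.cons x v : Fin (k + 1) → G) (Fin.cons x w : Fin (k + 1) → G) i.succ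

section Presentation

variable {G : Type*} [Group G] [MetricSpace G] {F₀ : ℕ → ContinuityModulus} {K : ℕ → Set G}

theorem IsPresentation.uniformContinuousOn_mul (hK : IsPresentation F₀ K) (n : ℕ) :
    UniformContinuousOn (fun p : G × G => p.1 * p.2) (K n ×ˢ K n) := by
  rw [Metric.uniformContinuousOn_iff]
  intro ε hε
  refine ⟨F₀ n ε, (F₀ n).pos ε hε, fun p hp q hq h => ?_⟩
  rw [Prod.dist_eq, max_lt_iff] at h
  exact hK.mul_modulus n ε hε _ hp.1 _ hq.1 _ hp.2 _ hq.2 h.1 h.2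

/-- Inversion is uniformly continuous on each `K n`, because `x⁻¹ = (x⁻¹ * y) * y⁻¹` and
`y⁻¹ = (x⁻¹ * x) * y⁻¹`. -/
theorem IsPresentation.uniformContinuousOn_inv (hK : IsPresentation F₀ K) (n : ℕ) :
    UniformContinuousOn (fun x : G => x⁻¹) (K n) := by
  rw [Metric.uniformContinuousOn_iff]
  intro ε hε
  have h2 := (F₀ (n + 2)).pos ε hε
  have h1 := (F₀ (n + 1)).pos _ h2
  refine ⟨_, h1, fun x hx y hy hxy => ?_⟩
  have up : ∀ z ∈ K n, z ∈ K (n + 1) := hK.mono n.le_succ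
  have up' : ∀ z ∈ K (n + 1), z ∈ K (n + 2) := hK.mono (n + 1).le_succ
  have hxi := hK.inv_mem n x hx
  have hyi := hK.inv_mem n y hy
  have h3 : dist (x⁻¹ * y) (x⁻¹ * x) < F₀ (n + 2) ε :=
    hK.mul_modulus (n + 1) _ h2 _ hxi _ hxi _ (up y hy) _ (up x hx) (by simpa using h1)
      (by rwa [dist_comm])
  have h4 := hK.mul_modulus (n + 2) ε hε _ (hK.mul_mem (n + 1) _ hxi _ (up y hy)) _
    (hK.mul_mem (n + 1) _ hxi _ (up x hx)) _ (up' _ hyi) _ (up' _ hyi) h3 (by simpa using h2)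
  simpa using h4

theorem GroupTerm.eval_mem (hK : IsPresentation F₀ K) {k : ℕ} {s : Fin k → ℕ} {v : Fin k → G}
    (hv : v ∈ sortedTuples K s) {n : ℕ} (t : GroupTerm s n) : t.eval v ∈ K n := by
  induction t with
  | var i => exact hv i
  | one n => exact hK.one_mem n
  | mul t u iht ihu => exact hK.mul_mem _ _ iht _ ihu
  | inv t iht => exact hK.inv_mem _ _ iht

theorem UniformContinuousOn.pair {X Y Z : Type*} [UniformSpace X] [UniformSpace Y]
    [UniformSpace Z] {S : Set X} {f : X → Y} {g : X → Z} (hf : UniformContinuousOn f S)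
    (hg : UniformContinuousOn g S) : UniformContinuousOn (fun x => (f x, g x)) S := by
  rw [uniformContinuousOn_iff_restrict] at hf hg ⊢
  exact hf.prodMk hg

theorem GroupTerm.uniformContinuousOn_eval (hK : IsPresentation F₀ K) {k : ℕ} {s : Fin k → ℕ}
    {n : ℕ} (t : GroupTerm s n) :
    UniformContinuousOn (fun v : Fin k → G => t.eval v) (sortedTuples K s) := by
  induction t with
  | var i => exact (Pi.uniformContinuous_proj (fun _ : Fin k => G) i).uniformContinuousOn
  | one n => exact uniformContinuous_const.uniformContinuousOn
  | @mul n t u iht ihu =>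
    exact (hK.uniformContinuousOn_mul n).comp (iht.pair ihu)
      fun v hv => ⟨t.eval_mem hK hv, u.eval_mem hK hv⟩
  | @inv n t iht =>
    exact (hK.uniformContinuousOn_inv n).comp iht fun v hv => t.eval_mem hK hv

theorem GroupFormula.exists_abs_eval_le (hK : IsPresentation F₀ K) {k : ℕ} {s : Fin k → ℕ}
    (φ : GroupFormula s) : ∃ b : ℝ, 0 ≤ b ∧ ∀ v ∈ sortedTuples K s, |φ.eval K v| ≤ b := by
  induction φ with
  | const q => exact ⟨|(q : ℝ)|, abs_nonneg _, fun v _ => le_rfl⟩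
  | @dist k s n t u =>
    refine ⟨Metric.diam (K n), Metric.diam_nonneg, fun v hv => ?_⟩
    rw [eval, abs_of_nonneg dist_nonneg]
    exact Metric.dist_le_diam_of_mem (hK.isBounded n) (t.eval_mem hK hv) (u.eval_mem hK hv)
  | half φ ih =>
    obtain ⟨b, hb, h⟩ := ih
    refine ⟨b, hb, fun v hv => ?_⟩
    rw [eval, abs_div, abs_two]
    linarith [h v hv, abs_nonneg (φ.eval K v)]
  | monus φ ψ ih₁ ih₂ | min φ ψ ih₁ ih₂ | max φ ψ ih₁ ih₂ | absDiff φ ψ ih₁ ih₂ =>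
    obtain ⟨b, hb, h⟩ := ih₁
    obtain ⟨c, hc, h'⟩ := ih₂
    refine ⟨b + c, by positivity, fun v hv => ?_⟩
    have h1 := abs_le.1 (h v hv)
    have h2 := abs_le.1 (h' v hv)
    simp only [eval]
    grind
  | neg q φ ih =>
    obtain ⟨b, hb, h⟩ := ih
    refine ⟨|(q : ℝ)| + b, by positivity, fun v hv => ?_⟩
    rw [eval]
    exact (abs_sub _ _).trans (by gcongr; exact h v hv)
  | truncAdd q φ ψ ih₁ ih₂ =>
    obtain ⟨b, hb, h⟩ := ih₁
    obtain ⟨c, hc, h'⟩ := ih₂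
    refine ⟨b + c + |(q : ℝ)|, by positivity, fun v hv => ?_⟩
    have h1 := abs_le.1 (h v hv)
    have h2 := abs_le.1 (h' v hv)
    simp only [eval]
    grind
  | sup n φ ih =>
    obtain ⟨b, hb, h⟩ := ih
    refine ⟨b, hb, fun v hv => ?_⟩
    have h' := fun x : K n => h _ (cons_mem_sortedTuples hv x.2)
    simpa [eval] using abs_ciSup_sub_ciSup_le (g := fun _ : K n => (0 : ℝ))
      (bddAbove_range_of_abs_le h') (bddAbove_range_of_abs_le (c := 0) (by simp)) hb
      (by simpa using h')
  | inf n φ ih =>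
    obtain ⟨b, hb, h⟩ := ih
    refine ⟨b, hb, fun v hv => ?_⟩
    have h' := fun x : K n => h _ (cons_mem_sortedTuples hv x.2)
    simpa [eval] using abs_ciInf_sub_ciInf_le (g := fun _ : K n => (0 : ℝ))
      (bddBelow_range_of_abs_le h') (bddBelow_range_of_abs_le (c := 0) (by simp)) hb
      (by simpa using h')

/-- A function of two values that is `1`-Lipschitz in each of them preserves uniform
continuity. -/
theorem UniformContinuousOn.comp₂_of_abs_sub_le {X : Type*} [PseudoMetricSpace X] {S : Set X}
    {f g : X → ℝ} (hf : UniformContinuousOn f S) (hg : UniformContinuousOn g S) (c : ℝ → ℝ → ℝ)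
    (hc : ∀ a b a' b', |c a b - c a' b'| ≤ |a - a'| + |b - b'|) :
    UniformContinuousOn (fun x => c (f x) (g x)) S := by
  rw [Metric.uniformContinuousOn_iff] at hf hg ⊢
  intro ε hε
  obtain ⟨δ, hδ, h⟩ := hf (ε / 2) (half_pos hε)
  obtain ⟨δ', hδ', h'⟩ := hg (ε / 2) (half_pos hε)
  refine ⟨min δ δ', lt_min hδ hδ', fun x hx y hy hxy => ?_⟩
  have h1 := h x hx y hy (hxy.trans_le (min_le_left _ _))
  have h2 := h' x hx y hy (hxy.trans_le (min_le_right _ _))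
  rw [Real.dist_eq] at h1 h2 ⊢
  linarith [hc (f x) (g x) (f y) (g y)]

theorem GroupFormula.uniformContinuousOn_eval (hK : IsPresentation F₀ K) {k : ℕ} {s : Fin k → ℕ}
    (φ : GroupFormula s) :
    UniformContinuousOn (fun v : Fin k → G => φ.eval K v) (sortedTuples K s) := by
  induction φ with
  | const q => exact uniformContinuous_const.uniformContinuousOn
  | dist t u =>
    exact uniformContinuous_dist.comp_uniformContinuousOn
      ((t.uniformContinuousOn_eval hK).pair (u.uniformContinuousOn_eval hK))
  | half φ ih =>
    refine ih.comp₂_of_abs_sub_le ih (fun a _ => a / 2) fun a b a' b' => ?_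
    grind
  | monus φ ψ ih₁ ih₂ =>
    refine ih₁.comp₂_of_abs_sub_le ih₂ (fun a b => Max.max (a - b) 0) fun a b a' b' => ?_
    grind
  | min φ ψ ih₁ ih₂ =>
    refine ih₁.comp₂_of_abs_sub_le ih₂ (fun a b => Min.min a b) fun a b a' b' => ?_
    grind
  | max φ ψ ih₁ ih₂ =>
    refine ih₁.comp₂_of_abs_sub_le ih₂ (fun a b => Max.max a b) fun a b a' b' => ?_
    grind
  | absDiff φ ψ ih₁ ih₂ =>
    refine ih₁.comp₂_of_abs_sub_le ih₂ (fun a b => |a - b|) fun a b a' b' => ?_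
    grind
  | neg q φ ih =>
    refine ih.comp₂_of_abs_sub_le ih (fun a _ => (q : ℝ) - a) fun a b a' b' => ?_
    grind
  | truncAdd q φ ψ ih₁ ih₂ =>
    refine ih₁.comp₂_of_abs_sub_le ih₂ (fun a b => Min.min (a + b) (q : ℝ)) fun a b a' b' => ?_
    grind
  | sup n φ ih =>
    rw [Metric.uniformContinuousOn_iff] at ih ⊢
    intro ε hε
    obtain ⟨b, -, hb⟩ := φ.exists_abs_eval_le hK
    obtain ⟨δ, hδ, h⟩ := ih (ε / 2) (half_pos hε)
    refine ⟨δ, hδ, fun v hv w hw hvw => (?_ : _ ≤ _).trans_lt (half_lt_self hε)⟩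
    exact abs_ciSup_sub_ciSup_le
      (bddAbove_range_of_abs_le fun x : K n => hb _ (cons_mem_sortedTuples hv x.2))
      (bddAbove_range_of_abs_le fun x : K n => hb _ (cons_mem_sortedTuples hw x.2))
      (half_pos hε).le fun x => (h _ (cons_mem_sortedTuples hv x.2) _
        (cons_mem_sortedTuples hw x.2) (by rwa [dist_cons_cons])).le
  | inf n φ ih =>
    rw [Metric.uniformContinuousOn_iff] at ih ⊢
    intro ε hε
    obtain ⟨b, -, hb⟩ := φ.exists_abs_eval_le hK
    obtain ⟨δ, hδ, h⟩ := ih (ε / 2) (half_pos hε)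
    refine ⟨δ, hδ, fun v hv w hw hvw => (?_ : _ ≤ _).trans_lt (half_lt_self hε)⟩
    exact abs_ciInf_sub_ciInf_le
      (bddBelow_range_of_abs_le fun x : K n => hb _ (cons_mem_sortedTuples hv x.2))
      (bddBelow_range_of_abs_le fun x : K n => hb _ (cons_mem_sortedTuples hw x.2))
      (half_pos hε).le fun x => (h _ (cons_mem_sortedTuples hv x.2) _
        (cons_mem_sortedTuples hw x.2) (by rwa [dist_cons_cons])).le

end Presentation

/-! ### Closing a set under Skolem functions -/

/-- Every real function that is bounded below on a nonempty set has almost minimal values. -/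
theorem exists_forall_lt_add {X : Type*} {S : Set X} (hS : S.Nonempty) {f : X → ℝ} {b : ℝ}
    (hb : ∀ x ∈ S, b ≤ f x) {ε : ℝ} (hε : 0 < ε) : ∃ x ∈ S, ∀ y ∈ S, f x < f y + ε := by
  have hbdd : BddBelow (f '' S) := ⟨b, by rintro _ ⟨x, hx, rfl⟩; exact hb x hx⟩
  obtain ⟨_, ⟨x, hx, rfl⟩, hlt⟩ := exists_lt_of_csInf_lt (hS.image f) (lt_add_of_pos_right _ hε)
  exact ⟨x, hx, fun y hy => hlt.trans_le (by gcongr; exact csInf_le hbdd ⟨y, hy, rfl⟩)⟩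

/-- Names for the operations under which Skolem hulls are closed, indexed by their arity: the group operations, almost nearest points in the sorts, and Tarski–Vaught witnesses. -/
inductive SkolemFunction : ℕ → Type
  | one : SkolemFunction 0
  | mul : SkolemFunction 2
  | inv : SkolemFunction 1
  | nearest (m q : ℕ) : SkolemFunction 1
  | witness {k : ℕ} (s : Fin k → ℕ) (n : ℕ) (φ : GroupFormula (Fin.cons n s : Fin (k + 1) → ℕ))
      (q : ℕ) : SkolemFunction k

instance : Countable (Σ k, SkolemFunction k) := by
  let f : Fin 3 ⊕ (ℕ × ℕ) ⊕ (Σ (k : ℕ) (s : Fin k → ℕ) (n : ℕ),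
      GroupFormula (Fin.cons n s : Fin (k + 1) → ℕ) × ℕ) → Σ k, SkolemFunction k
    | .inl 0 => ⟨_, .one⟩
    | .inl 1 => ⟨_, .mul⟩
    | .inl 2 => ⟨_, .inv⟩
    | .inr (.inl (m, q)) => ⟨_, .nearest m q⟩
    | .inr (.inr ⟨_, s, n, φ, q⟩) => ⟨_, .witness s n φ q⟩
  refine Function.Surjective.countable (f := f) ?_
  rintro ⟨_, _ | _ | _ | ⟨m, q⟩ | ⟨s, n, φ, q⟩⟩
  exacts [⟨.inl 0, rfl⟩, ⟨.inl 1, rfl⟩, ⟨.inl 2, rfl⟩, ⟨.inr (.inl (m, q)), rfl⟩,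
    ⟨.inr (.inr ⟨_, s, n, φ, q⟩), rfl⟩]

section SkolemHull

variable {G : Type u} [Group G] [MetricSpace G]

/-- The interpretation of the Skolem functions in `G`. The accuracy of `nearest m q` and
`witness s n φ q` is `1 / (q + 1)`. Where no suitable element exists, the value is arbitrary. -/
noncomputable def SkolemFunction.interpret (K : ℕ → Set G) :
    {k : ℕ} → SkolemFunction k → (Fin k → G) → G
  | _, .one, _ => 1
  | _, .mul, v => v 0 * v 1
  | _, .inv, v => (v 0)⁻¹
  | _, .nearest m q, v => Classical.epsilon fun x =>
      x ∈ K m ∧ ∀ y ∈ K m, dist x (v 0) < dist y (v 0) + 1 / ((q : ℝ) + 1)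
  | k, .witness _ n φ q, v => Classical.epsilon fun x =>
      x ∈ K n ∧ ∀ y ∈ K n, φ.eval K (Fin.cons x v : Fin (k + 1) → G) <
        φ.eval K (Fin.cons y v : Fin (k + 1) → G) + 1 / ((q : ℝ) + 1)

/-- A set closed under the Skolem functions: a subgroup that contains almost nearest points of the
sorts to its elements, and almost minimizers of formulas with parameters in it. -/
structure IsSkolemHull (K : ℕ → Set G) (D : Subgroup G) : Prop where
  nearest : ∀ d ∈ D, ∀ m, (K m).Nonempty → ∀ ε > 0,
    ∃ x ∈ D, x ∈ K m ∧ ∀ y ∈ K m, dist x d < dist y d + ε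
  witness : ∀ {k : ℕ} (s : Fin k → ℕ) (n : ℕ)
    (φ : GroupFormula (Fin.cons n s : Fin (k + 1) → ℕ)) (v : Fin k → G), (∀ i, v i ∈ D) →
    v ∈ sortedTuples K s → (K n).Nonempty → ∀ ε > 0, ∃ x ∈ D, x ∈ K n ∧ ∀ y ∈ K n,
      φ.eval K (Fin.cons x v : Fin (k + 1) → G) < φ.eval K (Fin.cons y v : Fin (k + 1) → G) + ε

/-- The downward Löwenheim–Skolem argument: as there are only countably many Skolem functions, the
hull of an infinite set has the cardinality of that set. -/
theorem exists_isSkolemHull {F₀ : ℕ → ContinuityModulus} {K : ℕ → Set G}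
    (hK : IsPresentation F₀ K) (X : Set G) :
    ∃ D : Subgroup G, X ⊆ D ∧ #D ≤ max ℵ₀ #X ∧ IsSkolemHull K D := by
  let L : FirstOrder.Language := ⟨SkolemFunction, fun _ => Empty⟩
  let _ : L.Structure G := ⟨fun f v => SkolemFunction.interpret K f v, fun r => r.elim⟩
  let S : L.Substructure G := FirstOrder.Language.Substructure.closure L X
  have hmem : ∀ {k : ℕ} (f : SkolemFunction k) (v : Fin k → G), (∀ i, v i ∈ S) →
      f.interpret K v ∈ S := fun f v hv => S.fun_mem f v hv
  let D : Subgroup G :=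
    { carrier := S
      one_mem' := hmem .one ![] (by simp)
      mul_mem' := fun {a b} ha hb => hmem .mul ![a, b] (by simpa [Fin.forall_fin_two] using ⟨ha, hb⟩)
      inv_mem' := fun {a} ha => hmem .inv ![a] (by simpa using ha) }
  refine ⟨D, FirstOrder.Language.Substructure.subset_closure, ?_, ?_, ?_⟩
  · have h : lift.{0} #S ≤ max ℵ₀ (lift.{0} #X + lift.{u} #(Σ k, SkolemFunction k)) :=
      FirstOrder.Language.Substructure.lift_card_closure_le (L := L)
    have hc : lift.{u} #(Σ k, SkolemFunction k) ≤ ℵ₀ := by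
      rw [lift_le_aleph0]
      exact mk_le_aleph0
    rw [lift_uzero, lift_uzero] at h
    refine (show #D ≤ _ from h).trans (max_le (le_max_left _ _) ?_)
    exact (add_le_max _ _).trans
      (max_le (max_le (le_max_right _ _) (hc.trans (le_max_left _ _))) (le_max_left _ _))
  · intro d hd m hm ε hε
    obtain ⟨q, hq⟩ := exists_nat_one_div_lt hε
    have h := Classical.epsilon_spec (exists_forall_lt_add hm (f := fun x => dist x d) (b := 0)
      (fun _ _ => dist_nonneg) (show 0 < 1 / ((q : ℝ) + 1) by positivity))
    exact ⟨_, hmem (.nearest m q) ![d] (by simpa using (show d ∈ S from hd)), h.1,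
      fun y hy => (h.2 y hy).trans (by gcongr)⟩
  · intro k s n φ v hvD hv hn ε hε
    obtain ⟨q, hq⟩ := exists_nat_one_div_lt hε
    obtain ⟨b, -, hb⟩ := φ.exists_abs_eval_le hK
    have h := Classical.epsilon_spec (exists_forall_lt_add hn
      (f := fun x => φ.eval K (Fin.cons x v : Fin (k + 1) → G)) (b := -b)
      (fun x hx => (abs_le.1 (hb _ (cons_mem_sortedTuples hv hx))).1)
      (show 0 < 1 / ((q : ℝ) + 1) by positivity))
    exact ⟨_, hmem (.witness s n φ q) v hvD, h.1, fun y hy => (h.2 y hy).trans (by gcongr)⟩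

/-! ### The closure of a Skolem hull is elementary -/

section Infimum

variable {X : Type*} {S T : Set X} {f : X → ℝ} {b : ℝ}

theorem ciInf_subtype_eq_of_forall_exists_lt_add (hTS : T ⊆ S) (hb : ∀ x ∈ S, |f x| ≤ b)
    (h : ∀ x ∈ S, ∀ ε > 0, ∃ a ∈ T, f a < f x + ε) : ⨅ x : T, f x = ⨅ x : S, f x := by
  rcases S.eq_empty_or_nonempty with rfl | ⟨x₀, hx₀⟩
  · rw [Set.subset_empty_iff.1 hTS]
  · obtain ⟨a₀, ha₀, -⟩ := h x₀ hx₀ 1 one_pos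
    have : Nonempty S := ⟨⟨x₀, hx₀⟩⟩
    have : Nonempty T := ⟨⟨a₀, ha₀⟩⟩
    have hS : BddBelow (range fun x : S => f x) := bddBelow_range_of_abs_le fun x => hb x x.2
    have hT : BddBelow (range fun x : T => f x) :=
      bddBelow_range_of_abs_le fun x => hb x (hTS x.2)
    refine le_antisymm (le_ciInf fun x => le_of_forall_pos_le_add fun ε hε => ?_)
      (le_ciInf fun a => ciInf_le hS ⟨a, hTS a.2⟩)
    obtain ⟨a, ha, hlt⟩ := h x x.2 ε hε
    exact (ciInf_le hT ⟨a, ha⟩).trans hlt.le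

theorem ciSup_subtype_eq_of_forall_exists_lt_add (hTS : T ⊆ S) (hb : ∀ x ∈ S, |f x| ≤ b)
    (h : ∀ x ∈ S, ∀ ε > 0, ∃ a ∈ T, f x < f a + ε) : ⨆ x : T, f x = ⨆ x : S, f x := by
  rcases S.eq_empty_or_nonempty with rfl | ⟨x₀, hx₀⟩
  · rw [Set.subset_empty_iff.1 hTS]
  · obtain ⟨a₀, ha₀, -⟩ := h x₀ hx₀ 1 one_pos
    have : Nonempty S := ⟨⟨x₀, hx₀⟩⟩
    have : Nonempty T := ⟨⟨a₀, ha₀⟩⟩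
    have hS : BddAbove (range fun x : S => f x) := bddAbove_range_of_abs_le fun x => hb x x.2
    have hT : BddAbove (range fun x : T => f x) :=
      bddAbove_range_of_abs_le fun x => hb x (hTS x.2)
    refine le_antisymm (ciSup_le fun a => le_ciSup hS ⟨a, hTS a.2⟩)
      (ciSup_le fun x => le_of_forall_pos_le_add fun ε hε => ?_)
    obtain ⟨a, ha, hlt⟩ := h x x.2 ε hε
    exact hlt.le.trans (by gcongr; exact le_ciSup hT ⟨a, ha⟩)

end Infimum

variable {F₀ : ℕ → ContinuityModulus} {K : ℕ → Set G} {D : Subgroup G}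

/-- In every sort the hull is dense in its closure. This is what the almost nearest points are
for: an element of `K m` in the closure of `D` might otherwise be approximated only by elements of
`D` outside `K m`. -/
theorem IsSkolemHull.exists_dist_lt (hD : IsSkolemHull K D) {m : ℕ} {a : G}
    (ha : a ∈ closure (D : Set G)) (ham : a ∈ K m) {ε : ℝ} (hε : 0 < ε) :
    ∃ x ∈ D, x ∈ K m ∧ dist x a < ε := by
  have hε3 : 0 < ε / 3 := by positivity
  obtain ⟨d, hd, had⟩ := Metric.mem_closure_iff.1 ha (ε / 3) hε3
  obtain ⟨x, hx, hxm, hlt⟩ := hD.nearest d hd m ⟨a, ham⟩ (ε / 3) hε3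
  refine ⟨x, hx, hxm, ?_⟩
  have := dist_triangle_right x a d
  linarith [hlt a ham]

/-- The Tarski–Vaught property of the closure of a Skolem hull. It passes from the hull to the
closure because formulas are uniformly continuous. -/
theorem IsSkolemHull.exists_eval_lt_add (hD : IsSkolemHull K D) (hK : IsPresentation F₀ K)
    {k : ℕ} {s : Fin k → ℕ} {n : ℕ} (φ : GroupFormula (Fin.cons n s : Fin (k + 1) → ℕ))
    {v : Fin k → G} (hvD : ∀ i, v i ∈ closure (D : Set G)) (hv : v ∈ sortedTuples K s)
    {x : G} (hx : x ∈ K n) {ε : ℝ} (hε : 0 < ε) :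
    ∃ a ∈ D, a ∈ K n ∧ φ.eval K (Fin.cons a v : Fin (k + 1) → G) <
      φ.eval K (Fin.cons x v : Fin (k + 1) → G) + ε := by
  have hε3 : 0 < ε / 3 := by positivity
  obtain ⟨δ, hδ, huc⟩ :=
    Metric.uniformContinuousOn_iff.1 (φ.uniformContinuousOn_eval hK) (ε / 3) hε3
  choose w hwD hw hwv using fun i => hD.exists_dist_lt (hvD i) (hv i) hδ
  obtain ⟨a, haD, ha, hlt⟩ := hD.witness s n φ w hwD hw ⟨x, hx⟩ (ε / 3) hε3
  have hclose : ∀ y ∈ K n, |φ.eval K (Fin.cons y w : Fin (k + 1) → G) -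
      φ.eval K (Fin.cons y v : Fin (k + 1) → G)| < ε / 3 := fun y hy =>
    huc _ (cons_mem_sortedTuples hw hy) _ (cons_mem_sortedTuples hv hy)
      (by rw [dist_cons_cons]; exact (dist_pi_lt_iff hδ).2 hwv)
  refine ⟨a, haD, ha, ?_⟩
  linarith [hlt x hx, (abs_lt.1 (hclose a ha)).1, (abs_lt.1 (hclose x hx)).2]

theorem IsSkolemHull.isContinuouslyElementary_topologicalClosure [IsTopologicalGroup G]
    (hD : IsSkolemHull K D) (hK : IsPresentation F₀ K) :
    IsContinuouslyElementary K D.topologicalClosure := by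
  intro k s φ
  have hsub : ∀ n, (D.topologicalClosure : Set G) ∩ K n ⊆ K n := fun n => inter_subset_right
  induction φ with
  | const q => exact fun v _ => rfl
  | dist t u => exact fun v _ => rfl
  | half φ ih =>
    intro v hv
    simp only [GroupFormula.eval, ih v hv]
  | neg q φ ih =>
    intro v hv
    simp only [GroupFormula.eval, ih v hv]
  | monus φ ψ ih₁ ih₂ | min φ ψ ih₁ ih₂ | max φ ψ ih₁ ih₂ | absDiff φ ψ ih₁ ih₂
  | truncAdd q φ ψ ih₁ ih₂ =>
    intro v hv
    simp only [GroupFormula.eval, ih₁ v hv, ih₂ v hv]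
  | @sup k s n φ ih =>
    intro v hv
    have hvK : v ∈ sortedTuples K s := fun i => (hv i).2
    obtain ⟨b, -, hb⟩ := φ.exists_abs_eval_le hK
    simp only [GroupFormula.eval]
    rw [← ciSup_subtype_eq_of_forall_exists_lt_add (hsub n)
      (f := fun x => φ.eval K (Fin.cons x v : Fin (k + 1) → G))
      (fun x hx => hb _ (cons_mem_sortedTuples hvK hx)) fun x hx ε hε => ?_]
    · exact iSup_congr fun x => ih _ (cons_mem_sortedTuples
        (K := fun n => (D.topologicalClosure : Set G) ∩ K n) hv x.2)
    -- An almost maximizer of `φ` is an almost minimizer of the formula `0 - φ`.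
    · obtain ⟨a, haD, ha, hlt⟩ :=
        hD.exists_eval_lt_add hK (.neg 0 φ) (fun i => (hv i).1) hvK hx hε
      simp only [GroupFormula.eval] at hlt
      exact ⟨a, ⟨D.le_topologicalClosure haD, ha⟩, by linarith⟩
  | @inf k s n φ ih =>
    intro v hv
    have hvK : v ∈ sortedTuples K s := fun i => (hv i).2
    obtain ⟨b, -, hb⟩ := φ.exists_abs_eval_le hK
    simp only [GroupFormula.eval]
    rw [← ciInf_subtype_eq_of_forall_exists_lt_add (hsub n)
      (f := fun x => φ.eval K (Fin.cons x v : Fin (k + 1) → G))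
      (fun x hx => hb _ (cons_mem_sortedTuples hvK hx)) fun x hx ε hε => ?_]
    · exact iInf_congr fun x => ih _ (cons_mem_sortedTuples
        (K := fun n => (D.topologicalClosure : Set G) ∩ K n) hv x.2)
    · obtain ⟨a, haD, ha, hlt⟩ :=
        hD.exists_eval_lt_add hK φ (fun i => (hv i).1) hvK hx hε
      exact ⟨a, ⟨D.le_topologicalClosure haD, ha⟩, hlt⟩

end SkolemHull

/-! ### Subgroups without a fixed point -/

/-- Isometries of a real normed space are affine by the Mazur–Ulam theorem, so an action by
isometries is an action by affine isometries. -/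
noncomputable def affineIsometricAction {G E : Type*} [Group G] [NormedAddCommGroup E]
    [NormedSpace ℝ E] (α : G →* (E ≃ᵢ E)) : G →* (E ≃ᵃⁱ[ℝ] E) where
  toFun g := (α g).toRealAffineIsometryEquiv
  map_one' := by ext x; simp
  map_mul' g h := by ext x; simp

theorem not_hasFHForFActions_of_unbounded {G : Type u} [Group G] [MetricSpace G] {E : Type v}
    [NormedAddCommGroup E] [InnerProductSpace ℝ E] [CompleteSpace E] {K : ℕ → Set G}
    {F : ℕ → ℕ → ContinuityModulus} {α : G →* (E ≃ᵢ E)}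
    (hα : IsFContinuousAction K F fun g x => α g x) {A : Subgroup G} {g : ℕ → G}
    (hgA : ∀ n, g n ∈ A) (hg : ∀ n : ℕ, n < ‖α (g n) 0‖) :
    ¬ HasFHForFActions.{u, v} A (fun n => {a : A | (a : G) ∈ K n}) F := by
  intro hFH
  obtain ⟨x, hx⟩ := hFH E (affineIsometricAction (α.comp A.subtype)) fun n m ε hε a ha a' ha' =>
    hα n m ε hε a ha a' ha'
  -- An isometry that fixes `x` moves `0` by at most `2 * ‖x‖`.
  obtain ⟨n, hn⟩ := exists_nat_gt (2 * ‖x‖)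
  have hxn : α (g n) x = x := by simpa [affineIsometricAction] using hx ⟨g n, hgA n⟩
  have h1 : dist (α (g n) 0) x = ‖x‖ := by
    conv_lhs => rw [← hxn]
    rw [(α (g n)).dist_eq, dist_zero_left]
  have h2 := dist_triangle (α (g n) 0) x 0
  rw [h1, dist_zero_right, dist_zero_right] at h2
  linarith [hg n]

theorem mainTheorem6 {G : Type u} [Group G] [MetricSpace G] [IsTopologicalGroup G]
    {E : Type v} [NormedAddCommGroup E] [InnerProductSpace ℝ E] [CompleteSpace E]
    (F₀ : ℕ → ContinuityModulus) (F : ℕ → ℕ → ContinuityModulus)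
    (ν : ℕ → ℕ → ℕ) (hν₁ : ∀ m, Monotone fun n => ν n m) (hν₂ : ∀ n, Monotone (ν n))
    (K : ℕ → Set G) (α : G →* (E ≃ᵢ E)) (hα : InducesKGH F₀ ν F K α)
    (hfix : ¬ ∃ x : E, ∀ g : G, α g x = x)
    (C : Set G) (hC : C.Infinite) :
    ∃ A : Subgroup G, C ⊆ A ∧ IsClosed (A : Set G) ∧ IsContinuouslyElementary K A ∧
      densityCharacter A = densityCharacter C ∧
      ¬ HasFHForFActions.{u, v} A (fun n => {a : A | (a : G) ∈ K n}) F := by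
  have hK := hα.presentation
  obtain ⟨g, hg⟩ := exists_seq_unbounded_of_no_fixedPoint α hfix
  obtain ⟨B, hB, hBC⟩ := exists_dense_mk_eq_densityCharacter C
  obtain ⟨D, hXD, hDcard, hD⟩ := exists_isSkolemHull hK (Subtype.val '' B ∪ range g)
  have hCA : C ⊆ (D.topologicalClosure : Set G) := fun c hc =>
    closure_mono (subset_union_left.trans hXD) (Subtype.dense_iff.1 hB hc)
  refine ⟨D.topologicalClosure, hCA, D.isClosed_topologicalClosure,
    hD.isContinuouslyElementary_topologicalClosure hK,
    le_antisymm ?_ (densityCharacter_mono hCA hC),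
    not_hasFHForFActions_of_unbounded hα.fContinuous
      (fun n => D.le_topologicalClosure (hXD (.inr (mem_range_self n)))) hg⟩
  have := hC.to_subtype
  have hℵ : ℵ₀ ≤ densityCharacter C := aleph0_le_densityCharacter C
  calc densityCharacter D.topologicalClosure ≤ #D := densityCharacter_closure_le (D : Set G)
    _ ≤ max ℵ₀ #(Subtype.val '' B ∪ range g : Set G) := hDcard
    _ ≤ densityCharacter C := max_le hℵ ((mk_union_le _ _).trans (add_le_of_le hℵ
      (mk_image_le.trans hBC.le) ((mk_le_aleph0_iff.2 (countable_range g)).trans hℵ)))
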